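/- A staircase tableau of size $n\ge 0$ is a filling of the Young diagram of staircase shape $(n,n-1,\dots,2,1)$ (English notation) in which every box is either empty or labeled with one of $\alpha,\beta,\gamma,\delta$, such that no box on the diagonal (the last boxes of the rows) is empty, all boxes in the same row and to the left of a $\beta$ or a $\delta$ are empty, and all boxes in the same column and above an $\alpha$ or a $\gamma$ are empty. The type of a tableau $\mathcal T$ is the word in $\{\circ,\bullet\}^n$ obtained by reading the diagonal from northeast to southwest and writing $\bullet$ for each $\alpha$ or $\delta$ and $\circ$ for each $\beta$ or $\gamma$; let $t(\mathcal T)$ be the number of $\bullet$'s in it. The weight $\mathrm{wt}(\mathcal T)$ is the product, over all boxes, of the label of the box if it is labeled, and for an empty box of $u$ or $q$ according to the closest labels that it sees to its right in its row and below it in its column: $u$ if it sees a $\beta$ to its right; $q$ if it sees a $\delta$ to its right; $u$ if it sees an $\alpha$ or $\gamma$ to its right and an $\alpha$ or $\delta$ below; $q$ if it sees an $\alpha$ or $\gamma$ to its right and a $\beta$ or $\gamma$ below. Setting $u=1$, define $$Z_n(y;\alpha,\beta,\gamma,\delta;q)=\sum_{\mathcal T\text{ of size }n}\mathrm{wt}(\mathcal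 T)\,y^{t(\mathcal T)}.$$ **Proposition.** For every $n\ge 0$ and arbitrary parameters $\alpha,\beta,\gamma,q$ (elements of any commutative ring, for instance indeterminates), $$Z_n(1;\alpha,\beta,\gamma,-\beta;q)=\prod_{j=0}^{n-1}(\alpha+q^j\gamma).$$ -/

import Mathlib

/-- The four possible labels of a box. -/
inductive Label
  | alpha
  | beta
  | gamma
  | delta
  deriving DecidableEq

instance : Fintype Label where
  elems := {Label.alpha, Label.beta, Label.gamma, Label.delta}
  complete := by intro x; cases x <;> simp

/-- The two letters of the words that serve as types: the hole `∘` and the particle `•`. -/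
inductive Site
  | hole
  | particle
  deriving DecidableEq

instance : Fintype Site where
  elems := {Site.hole, Site.particle}
  complete := by intro x; cases x <;> simp

/-- The Young diagram of staircase shape `(n, n - 1, …, 2, 1)`, in English notation. The box
`(i, j)` lies in row `i` (counted from `0` at the top) and column `j` (counted from `0` at the
left). -/
def staircaseShape (n : ℕ) : YoungDiagram where
  cells := (Finset.range n ×ˢ Finset.range n).filter fun c => c.1 + c.2 < n
  isLowerSet := by
    rintro ⟨a, b⟩ ⟨c, d⟩ h hab
    obtain ⟨h1, h2⟩ := Prod.mk_le_mk.mp h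
    simp only [Finset.coe_filter, Finset.mem_product, Finset.mem_range, Set.mem_ofPred_eq] at hab ⊢
    omega

theorem mem_staircaseShape {n i j : ℕ} : (i, j) ∈ staircaseShape n ↔ i + j < n := by
  rw [← YoungDiagram.mem_cells]
  simp only [staircaseShape, Finset.mem_filter, Finset.mem_product, Finset.mem_range]
  omega

/-- A staircase tableau of size `n`: a filling of the boxes of the staircase shape, `none` being
an empty box. As for Mathlib's semistandard tableaux, the filling is extended by the default value
(here `none`) outside the shape, so that equal tableaux have equal entry functions. -/
@[ext]
structure StaircaseTableau (n : ℕ) where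
  /-- The content of the box in row `i` and column `j`. -/
  entry : ℕ → ℕ → Option Label
  /-- There is nothing outside the shape. -/
  entry_outside : ∀ i j, (i, j) ∉ staircaseShape n → entry i j = none
  /-- No box on the diagonal is empty. -/
  diagonal : ∀ i j, i + j + 1 = n → entry i j ≠ none
  /-- All boxes in the same row and to the left of a `β` or a `δ` are empty. -/
  left_empty : ∀ i j j', j' < j → (entry i j = some Label.beta ∨ entry i j = some Label.delta) →
    entry i j' = none
  /-- All boxes in the same column and above an `α` or a `γ` are empty. -/
  above_empty : ∀ i i' j, i' < i → (entry i j = some Label.alpha ∨ entry i j = some Label.gamma) →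
    entry i' j = none

namespace StaircaseTableau

variable {n : ℕ}

instance : Finite (StaircaseTableau n) := by
  refine Finite.of_injective
    (fun (T : StaircaseTableau n) (i j : Fin n) => T.entry i j) fun S T h => ?_
  ext1
  funext i j
  by_cases hij : i + j < n
  · exact congrFun (congrFun h ⟨i, by omega⟩) ⟨j, by omega⟩
  · rw [S.entry_outside i j (by rwa [mem_staircaseShape]),
      T.entry_outside i j (by rwa [mem_staircaseShape])]

noncomputable instance : Fintype (StaircaseTableau n) := Fintype.ofFinite _

/-- The letter of the type contributed by a diagonal box: `•` for `α` and `δ`, `∘` for `β` and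
`γ`. (A diagonal box is never empty.) -/
def siteOf : Option Label → Site
  | some Label.alpha => Site.particle
  | some Label.delta => Site.particle
  | some Label.beta => Site.hole
  | some Label.gamma => Site.hole
  | none => Site.hole

/-- The type of a tableau: the word in `{∘, •}ⁿ` read along the diagonal from northeast to
southwest. -/
def type (T : StaircaseTableau n) : Fin n → Site :=
  fun k => siteOf (T.entry k (n - 1 - k))

/-- The number `t(T)` of particles in the type of `T`. -/
def particles (T : StaircaseTableau n) : ℕ :=
  (Finset.univ.filter fun k => T.type k = Site.particle).card

/-- The label of the closest labeled box to the right of `(i, j)` in row `i`. -/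
def rightLabel (T : StaircaseTableau n) (i j : ℕ) : Option Label :=
  (List.range n).findSome? fun k => T.entry i (j + 1 + k)

/-- The label of the closest labeled box below `(i, j)` in column `j`. -/
def belowLabel (T : StaircaseTableau n) (i j : ℕ) : Option Label :=
  (List.range n).findSome? fun k => T.entry (i + 1 + k) j

/-- Every box off the diagonal sees a label to its right. -/
theorem rightLabel_ne_none (T : StaircaseTableau n) {i j : ℕ} (h : i + j + 1 < n) :
    T.rightLabel i j ≠ none := by
  intro h0
  rw [rightLabel, List.findSome?_eq_none_iff] at h0
  exact T.diagonal i (j + 1 + (n - i - j - 2)) (by omega)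
    (h0 (n - i - j - 2) (by rw [List.mem_range]; omega))

/-- Every box off the diagonal sees a label below it. -/
theorem belowLabel_ne_none (T : StaircaseTableau n) {i j : ℕ} (h : i + j + 1 < n) :
    T.belowLabel i j ≠ none := by
  intro h0
  rw [belowLabel, List.findSome?_eq_none_iff] at h0
  exact T.diagonal (i + 1 + (n - i - j - 2)) j (by omega)
    (h0 (n - i - j - 2) (by rw [List.mem_range]; omega))

section Weight

variable {R : Type*} [CommRing R]

/-- The value of a label under a choice of the four parameters. -/
def labelValue (α β γ δ : R) : Label → R
  | Label.alpha => α
  | Label.beta => β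
  | Label.gamma => γ
  | Label.delta => δ

/-- The factor of a blank box, given the labels that it sees to its right and below it. The last
case does not occur, since every blank box of a tableau sees a label in both directions. -/
def blankValue (q u : R) : Option Label → Option Label → R
  | some Label.beta, _ => u
  | some Label.delta, _ => q
  | some Label.alpha, some Label.alpha => u
  | some Label.alpha, some Label.delta => u
  | some Label.gamma, some Label.alpha => u
  | some Label.gamma, some Label.delta => u
  | some Label.alpha, some Label.beta => q
  | some Label.alpha, some Label.gamma => q
  | some Label.gamma, some Label.beta => q
  | some Label.gamma, some Label.gamma => q
  | _, _ => 1

/-- The factor of the box `(i, j)`. -/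
def boxValue (T : StaircaseTableau n) (α β γ δ q u : R) (i j : ℕ) : R :=
  match T.entry i j with
  | some l => labelValue α β γ δ l
  | none => blankValue q u (T.rightLabel i j) (T.belowLabel i j)

/-- The weight of a tableau: the product of the factors of all boxes of its shape. -/
def wt (T : StaircaseTableau n) (α β γ δ q u : R) : R :=
  ∏ c ∈ (staircaseShape n).cells, T.boxValue α β γ δ q u c.1 c.2

end Weight

end StaircaseTableau

/-- The fugacity partition function `Z_n(y; α, β, γ, δ; q)`: the sum of `wt(T) y ^ t(T)` over all
staircase tableaux of size `n`, with `u = 1`. -/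
noncomputable def fugacityZ {R : Type*} [CommRing R] (n : ℕ) (y α β γ δ q : R) : R :=
  ∑ T : StaircaseTableau n, T.wt α β γ δ q 1 * y ^ T.particles

/-! Tableaux are built by adding columns on the left. Let `P n w` be the sum of the weights with `X`
marking each row that starts with `α` or `γ` and `w` each row that starts with `δ`; at `X = w = 1`
it is the partition function. In front of a row starting with `β` or `δ` only an empty box fits, of
factor `1` or `q`. Hence `P (n + 1) w = T_w (P n (q w))` for a linear operator `T_w`
(`columnOperator`), and a transfer recursion over the boxes of the column shows that the polynomials
`T_w (X ^ k)` satisfy a second-order recurrence in `k` (`columnState_quadratic`).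

A second operator `U_w` (`commutingOperator`) has the same recurrence and other initial values,
chosen so that `U_w T_{qw} = T_w U_{qw}`, `U_w 1 = α + γ w` and `X U_1 = T_1`. The last identity is
where `δ = -β` matters: the constants `β + δ w` become `β (1 - w)` and vanish at `w = 1`. Moving `U`
through all the `T`s gives `U_w (P n (q w)) = (α + q ^ n w γ) P n w`, so `P (n + 1) 1 = X U_1 (P n
q) = (α + q ^ n γ) X P n 1`, which is the product formula. -/

/-! ### Column operators and their commutation relation -/

section Operators

open Polynomial

variable {R : Type*} [CommRing R]

/-- The sequence with first terms `s₀`, `s₁` and `s (k + 2) = u * s (k + 1) - v * s k`. -/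
def recurrentSeq (u v s₀ s₁ : R) : ℕ → R
  | 0 => s₀
  | 1 => s₁
  | k + 2 => u * recurrentSeq u v s₀ s₁ (k + 1) - v * recurrentSeq u v s₀ s₁ k

/-- The linear operator on polynomials that maps `X ^ k` to `s k`. -/
noncomputable def seqOperator (s : ℕ → R[X]) : R[X] →ₗ[R] R[X] :=
  (Polynomial.basisMonomials R).constr R s

theorem seqOperator_X_pow (s : ℕ → R[X]) (k : ℕ) : seqOperator s (X ^ k) = s k := by
  have := (Polynomial.basisMonomials R).constr_basis R s k
  simpa only [seqOperator, coe_basisMonomials, monomial_one_right_eq_X_pow] using this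

theorem linearMap_ext_X_pow {L M : R[X] →ₗ[R] R[X]} (h : ∀ k, L (X ^ k) = M (X ^ k)) : L = M := by
  refine (Polynomial.basisMonomials R).ext fun k => ?_
  simpa only [coe_basisMonomials, monomial_one_right_eq_X_pow] using h k

theorem linearMap_C_mul (L : R[X] →ₗ[R] R[X]) (c : R) (f : R[X]) : L (C c * f) = C c * L f := by
  rw [C_mul', C_mul', map_smul]

/-- The quadratic exchange relation between an operator and the multiplication by `X`. -/
def QuadraticRelation (β q w : R) (L : R[X] →ₗ[R] R[X]) : Prop :=
  ∀ f, L (X ^ 2 * f) = (C (1 + q) * X + C (β * (1 - w))) * L (X * f)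
    - (C q * X ^ 2 + C (β * (1 - q * w)) * X) * L f

theorem QuadraticRelation.of_X_pow {β q w : R} {L : R[X] →ₗ[R] R[X]}
    (h : ∀ k, L (X ^ (k + 2)) = (C (1 + q) * X + C (β * (1 - w))) * L (X ^ (k + 1))
      - (C q * X ^ 2 + C (β * (1 - q * w)) * X) * L (X ^ k)) :
    QuadraticRelation β q w L := by
  intro f
  induction f using Polynomial.induction_on' with
  | add f g hf hg =>
    simp only [mul_add, map_add, hf, hg]
    ring
  | monomial k c =>
    have h2 : (X ^ 2 * monomial k c : R[X]) = C c * X ^ (k + 2) := by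
      rw [← C_mul_X_pow_eq_monomial]; ring
    have h1 : (X * monomial k c : R[X]) = C c * X ^ (k + 1) := by
      rw [← C_mul_X_pow_eq_monomial]; ring
    rw [h2, h1, ← C_mul_X_pow_eq_monomial, linearMap_C_mul, linearMap_C_mul, linearMap_C_mul, h]
    ring

/-- The composite of two operators in consecutive quadratic relations satisfies a cubic one. -/
theorem QuadraticRelation.comp_cubic {β q w : R} {A B : R[X] →ₗ[R] R[X]}
    (hA : QuadraticRelation β q w A) (hB : QuadraticRelation β q (q * w) B) (f : R[X]) :
    A (B (X ^ 3 * f)) =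
      ((C q * X + C (β * (1 - q * w))) + (C (1 + q ^ 2) * X + C (β * (1 + q) * (1 - w))))
          * A (B (X ^ 2 * f))
        - ((C q * X + C (β * (1 - q * w))) * (C (1 + q ^ 2) * X + C (β * (1 + q) * (1 - w)))
          + X * (C (q ^ 2) * X + C (β * (1 + q) * (1 - q ^ 2 * w)))) * A (B (X * f))
        + (C q * X + C (β * (1 - q * w)))
          * (X * (C (q ^ 2) * X + C (β * (1 + q) * (1 - q ^ 2 * w)))) * A (B f) := by
  have hB2 := hB f
  have hB3 := hB (X * f)
  rw [show X ^ 2 * (X * f) = X ^ 3 * f by ring, show X * (X * f) = X ^ 2 * f by ring, hB2] at hB3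
  rw [hB3, hB2]
  generalize B f = b
  generalize B (X * f) = d
  -- `A` commutes with constants but not with `X`, so powers of `X` stay inside `A` until its own
  -- quadratic relation reduces them.
  have e2 : A ((C (1 + q) * X + C (β * (1 - q * w))) * d
      - (C q * X ^ 2 + C (β * (1 - q * (q * w))) * X) * b) =
      C (1 + q) * A (X * d) + C (β * (1 - q * w)) * A d - C q * A (X ^ 2 * b)
        - C (β * (1 - q * (q * w))) * A (X * b) := by
    rw [← linearMap_C_mul, ← linearMap_C_mul, ← linearMap_C_mul, ← linearMap_C_mul, ← map_add,
      ← map_sub, ← map_sub]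
    congr 1
    ring
  have e3 : A ((C (1 + q) * X + C (β * (1 - q * w))) * ((C (1 + q) * X + C (β * (1 - q * w))) * d
      - (C q * X ^ 2 + C (β * (1 - q * (q * w))) * X) * b)
      - (C q * X ^ 2 + C (β * (1 - q * (q * w))) * X) * d) =
      C ((1 + q) ^ 2 - q) * A (X ^ 2 * d)
        + C (2 * (1 + q) * (β * (1 - q * w)) - β * (1 - q * (q * w))) * A (X * d)
        + C ((β * (1 - q * w)) ^ 2) * A d
        - C ((1 + q) * q) * A (X ^ 2 * (X * b))
        - C ((1 + q) * (β * (1 - q * (q * w))) + β * (1 - q * w) * q) * A (X ^ 2 * b)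
        - C (β * (1 - q * w) * (β * (1 - q * (q * w)))) * A (X * b) := by
    simp only [← linearMap_C_mul, ← map_add, ← map_sub]
    congr 1
    simp only [map_add, map_sub, map_mul, map_pow, map_one, map_ofNat]
    ring
  -- Everything is now expressed through `A (X * d)`, `A d`, `A (X * b)`, `A b`. The parts of `A (B
  -- (X ^ 3 * f))` and `A (B (X ^ 2 * f))` in `A (X * d)` and `A (X * b)` are proportional, because
  -- `B` has parameter `q * w`; hence order three suffices. The characteristic polynomial has the
  -- form `(t - r) (t ^ 2 - s t + p)`, with `r = q X + β (1 - q w)`.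
  rw [e2, e3, hA (X * b), show X * (X * b) = X ^ 2 * b by ring, hA b, hA d]
  simp only [map_add, map_sub, map_mul, map_pow, map_one, map_ofNat]
  ring

/-- The images of the monomials under the operator that adds a column. -/
noncomputable def columnSeq (α β γ q w : R) : ℕ → R[X] :=
  recurrentSeq (C (1 + q) * X + C (β * (1 - w))) (C q * X ^ 2 + C (β * (1 - q * w)) * X)
    (C (α + γ) * X + C (β * (1 - w)))
    (C (α + γ * q) * X ^ 2 + C (β * (q - w)) * X
      + C (β * (1 - w)) * (C (α + γ) * X + C (β * (1 - w))))

/-- The operator on generating polynomials that adds a column. -/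
noncomputable def columnOperator (α β γ q w : R) : R[X] →ₗ[R] R[X] :=
  seqOperator (columnSeq α β γ q w)

/-- The images of the monomials under the operator that commutes with the addition of columns. -/
noncomputable def commutingSeq (α β γ q w : R) : ℕ → R[X] :=
  recurrentSeq (C (1 + q) * X + C (β * (1 - w))) (C q * X ^ 2 + C (β * (1 - q * w)) * X)
    (C (α + γ * w)) (C (α + γ * q * w) * X - C (β * (1 - q) * w))

/-- The operator that commutes with the addition of columns. -/
noncomputable def commutingOperator (α β γ q w : R) : R[X] →ₗ[R] R[X] :=
  seqOperator (commutingSeq α β γ q w)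

theorem columnOperator_quadratic (α β γ q w : R) :
    QuadraticRelation β q w (columnOperator α β γ q w) :=
  .of_X_pow fun k => by simp only [columnOperator, seqOperator_X_pow]; rfl

theorem commutingOperator_quadratic (α β γ q w : R) :
    QuadraticRelation β q w (commutingOperator α β γ q w) :=
  .of_X_pow fun k => by simp only [commutingOperator, seqOperator_X_pow]; rfl

theorem columnOperator_one (α β γ q w : R) :
    columnOperator α β γ q w 1 = C (α + γ) * X + C (β * (1 - w)) := by
  rw [← pow_zero X, columnOperator, seqOperator_X_pow]; rfl

theorem columnOperator_X (α β γ q w : R) :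
    columnOperator α β γ q w X = C (α + γ * q) * X ^ 2 + C (β * (q - w)) * X
      + C (β * (1 - w)) * (C (α + γ) * X + C (β * (1 - w))) := by
  conv_lhs => rw [← pow_one X, columnOperator, seqOperator_X_pow]
  rfl

theorem commutingOperator_one (α β γ q w : R) :
    commutingOperator α β γ q w 1 = C (α + γ * w) := by
  rw [← pow_zero X, commutingOperator, seqOperator_X_pow]; rfl

theorem commutingOperator_X (α β γ q w : R) :
    commutingOperator α β γ q w X = C (α + γ * q * w) * X - C (β * (1 - q) * w) := by
  conv_lhs => rw [← pow_one X, commutingOperator, seqOperator_X_pow]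
  rfl

theorem QuadraticRelation.X_sq {β q w : R} {L : R[X] →ₗ[R] R[X]} (h : QuadraticRelation β q w L) :
    L (X ^ 2) = (C (1 + q) * X + C (β * (1 - w))) * L X
      - (C q * X ^ 2 + C (β * (1 - q * w)) * X) * L 1 := by
  simpa using h 1

theorem QuadraticRelation.X_cube {β q w : R} {L : R[X] →ₗ[R] R[X]}
    (h : QuadraticRelation β q w L) :
    L (X ^ 3) = (C (1 + q) * X + C (β * (1 - w))) * L (X ^ 2)
      - (C q * X ^ 2 + C (β * (1 - q * w)) * X) * L X := by
  have := h X
  rwa [← pow_succ, ← pow_two] at this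

theorem linearMap_cubic (L : R[X] →ₗ[R] R[X]) (a b c d : R) :
    L (C a * X ^ 3 + C b * X ^ 2 + C c * X + C d) =
      C a * L (X ^ 3) + C b * L (X ^ 2) + C c * L X + C d * L 1 := by
  rw [← mul_one (C d), map_add, map_add, map_add]
  simp only [linearMap_C_mul]
  ring

/-- The quadratic relations do not involve `α` and `γ`, so by `QuadraticRelation.comp_cubic` both
composites satisfy the same third-order recurrence on the powers of `X`. It remains to compare them
on `1`, `X` and `X ^ 2`. -/
theorem commutingOperator_comp_columnOperator (α β γ q w : R) :
    commutingOperator α β γ q w ∘ₗ columnOperator α β γ q (q * w) =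
      columnOperator α β γ q w ∘ₗ commutingOperator α β γ q (q * w) := by
  have hU := commutingOperator_quadratic α β γ q w
  have hU' := commutingOperator_quadratic α β γ q (q * w)
  have hT := columnOperator_quadratic α β γ q w
  have hT' := columnOperator_quadratic α β γ q (q * w)
  have key : ∀ k, (commutingOperator α β γ q w (columnOperator α β γ q (q * w) (X ^ k)) =
      columnOperator α β γ q w (commutingOperator α β γ q (q * w) (X ^ k))) := by
    intro k
    induction k using Nat.strong_induction_on with
    | _ k ih =>
    match k, ih with
    | 0, _ =>
      rw [pow_zero, columnOperator_one, commutingOperator_one]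
      have e1 := linearMap_cubic (commutingOperator α β γ q w) 0 0 (α + γ) (β * (1 - q * w))
      have e2 := linearMap_cubic (columnOperator α β γ q w) 0 0 0 (α + γ * (q * w))
      simp only [map_zero, zero_mul, zero_add] at e1 e2
      rw [e1, e2, commutingOperator_one, commutingOperator_X, columnOperator_one]
      simp only [map_add, map_sub, map_mul, map_one]
      ring
    | 1, _ =>
      rw [pow_one, columnOperator_X, commutingOperator_X]
      have e1 := linearMap_cubic (commutingOperator α β γ q w) 0 (α + γ * q)
        (β * (q - q * w) + β * (1 - q * w) * (α + γ)) ((β * (1 - q * w)) ^ 2)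
      have e2 := linearMap_cubic (columnOperator α β γ q w) 0 0 (α + γ * q * (q * w))
        (-(β * (1 - q) * (q * w)))
      have s1 : C (α + γ * q) * X ^ 2 + C (β * (q - q * w)) * X
          + C (β * (1 - q * w)) * (C (α + γ) * X + C (β * (1 - q * w))) =
          C 0 * X ^ 3 + C (α + γ * q) * X ^ 2
            + C (β * (q - q * w) + β * (1 - q * w) * (α + γ)) * X + C ((β * (1 - q * w)) ^ 2) := by
        simp only [map_add, map_sub, map_mul, map_pow, map_one, map_zero]
        ring
      have s2 : C (α + γ * q * (q * w)) * X - C (β * (1 - q) * (q * w)) =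
          C 0 * X ^ 3 + C 0 * X ^ 2 + C (α + γ * q * (q * w)) * X
            + C (-(β * (1 - q) * (q * w))) := by
        simp only [map_zero, map_neg]
        ring
      rw [s1, s2, e1, e2, hU.X_sq, commutingOperator_one, commutingOperator_X, columnOperator_one,
        columnOperator_X]
      simp only [map_add, map_sub, map_mul, map_pow, map_one, map_zero, map_neg]
      ring
    | 2, _ =>
      rw [hU'.X_sq, hT'.X_sq, columnOperator_X, commutingOperator_X, columnOperator_one,
        commutingOperator_one]
      -- The coefficients in `e1` and `e2` are those of the inner images of `X ^ 2`, expanded in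
      -- powers of `X`.
      have e1 := linearMap_cubic (commutingOperator α β γ q w)
        ((1 + q) * (α + γ * q) - q * (α + γ))
        ((1 + q) * (β * (q - q * w) + β * (1 - q * w) * (α + γ)) + β * (1 - q * w) * (α + γ * q)
          - q * (β * (1 - q * w)) - β * (1 - q * (q * w)) * (α + γ))
        ((1 + q) * (β * (1 - q * w)) ^ 2
          + β * (1 - q * w) * (β * (q - q * w) + β * (1 - q * w) * (α + γ))
          - β * (1 - q * (q * w)) * (β * (1 - q * w)))
        ((β * (1 - q * w)) ^ 3)
      have e2 := linearMap_cubic (columnOperator α β γ q w) 0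
        ((1 + q) * (α + γ * q * (q * w)) - q * (α + γ * (q * w)))
        (-(1 + q) * (β * (1 - q) * (q * w)) + β * (1 - q * w) * (α + γ * q * (q * w))
          - β * (1 - q * (q * w)) * (α + γ * (q * w)))
        (-(β * (1 - q * w)) * (β * (1 - q) * (q * w)))
      refine (congrArg _ ?_).trans (e1.trans (Eq.trans ?_ (e2.symm.trans (congrArg _ ?_))))
      · simp only [map_add, map_sub, map_mul, map_pow, map_one]
        ring
      · rw [hU.X_cube, hU.X_sq, hT.X_sq, commutingOperator_one, commutingOperator_X,
          columnOperator_one, columnOperator_X]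
        simp only [map_add, map_sub, map_mul, map_pow, map_one, map_zero, map_neg]
        ring
      · simp only [map_add, map_sub, map_mul, map_one, map_zero, map_neg]
        ring
    | k + 3, ih =>
      have h0 := ih k (by omega)
      have h1 := ih (k + 1) (by omega)
      have h2 := ih (k + 2) (by omega)
      rw [pow_succ'] at h1
      rw [add_comm, pow_add] at h2
      rw [add_comm, pow_add, hU.comp_cubic hT', hT.comp_cubic hU', h0, h1, h2]
  exact linearMap_ext_X_pow key

/-- At `w = 1` the terms `β (1 - w)` drop out, and the initial values of `columnSeq` are `X` times
those of `commutingSeq`; the recurrences agree. -/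
theorem X_mul_commutingOperator (α β γ q : R) (f : R[X]) :
    X * commutingOperator α β γ q 1 f = columnOperator α β γ q 1 f := by
  have : LinearMap.mulLeft R X ∘ₗ commutingOperator α β γ q 1 = columnOperator α β γ q 1 := by
    refine linearMap_ext_X_pow fun k => ?_
    rw [LinearMap.comp_apply, LinearMap.mulLeft_apply, commutingOperator, columnOperator,
      seqOperator_X_pow, seqOperator_X_pow]
    induction k using Nat.twoStepInduction with
    | zero =>
      simp only [commutingSeq, columnSeq, recurrentSeq, map_add, map_sub, map_mul, map_one]
      ring
    | one =>
      simp only [commutingSeq, columnSeq, recurrentSeq, map_add, map_sub, map_mul, map_one]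
      ring
    | more k h0 h1 =>
      rw [commutingSeq, columnSeq, recurrentSeq, recurrentSeq, ← commutingSeq, ← columnSeq, ← h0,
        ← h1]
      ring
  exact LinearMap.congr_fun this f

/-- Iterated addition of columns, starting from the empty tableau. -/
noncomputable def columnIterate (α β γ q : R) : ℕ → R → R[X]
  | 0, _ => 1
  | n + 1, w => columnOperator α β γ q w (columnIterate α β γ q n (q * w))

/-- Each exchange with a column operator multiplies the parameter of the commuting operator by `q`;
after `n` exchanges it acts on `1` with parameter `q ^ n * w`. -/
theorem commutingOperator_columnIterate (α β γ q : R) (n : ℕ) (w : R) :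
    commutingOperator α β γ q w (columnIterate α β γ q n (q * w)) =
      C (α + q ^ n * w * γ) * columnIterate α β γ q n w := by
  induction n generalizing w with
  | zero =>
    rw [columnIterate, columnIterate, commutingOperator_one, mul_one, pow_zero, one_mul, mul_comm γ]
  | succ n ih =>
    have := LinearMap.congr_fun (commutingOperator_comp_columnOperator α β γ q w)
      (columnIterate α β γ q n (q * (q * w)))
    rw [LinearMap.comp_apply, LinearMap.comp_apply] at this
    rw [columnIterate, this, ih, linearMap_C_mul, columnIterate]
    congr 3
    ring

theorem columnIterate_one (α β γ q : R) (n : ℕ) :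
    columnIterate α β γ q n 1 = C (∏ j ∈ Finset.range n, (α + q ^ j * γ)) * X ^ n := by
  induction n with
  | zero => simp [columnIterate]
  | succ n ih =>
    rw [columnIterate, ← X_mul_commutingOperator, commutingOperator_columnIterate, ih,
      Finset.prod_range_succ, map_mul, mul_one]
    ring

end Operators

/-! ### Closest labels in finite columns -/

/-- The first label among the values of `f` at `0, …, m - 1`. -/
def firstLabel (m : ℕ) (f : ℕ → Option Label) : Option Label :=
  (List.range m).findSome? f

theorem firstLabel_zero (f : ℕ → Option Label) : firstLabel 0 f = none := rfl

theorem firstLabel_succ (m : ℕ) (f : ℕ → Option Label) :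
    firstLabel (m + 1) f = (f 0).or (firstLabel m fun k => f (k + 1)) := by
  rw [firstLabel, List.range_succ_eq_map, List.findSome?_cons, List.findSome?_map]
  cases f 0 <;> rfl

/-- Reconciles search lengths: a search in size `n + 1` reads one box more than the same search in
size `n`, and that box lies outside the shape. -/
theorem firstLabel_succ_of_last_eq_none {m : ℕ} (f : ℕ → Option Label) (h : f m = none) :
    firstLabel (m + 1) f = firstLabel m f := by
  rw [firstLabel, List.range_succ, List.findSome?_append, List.findSome?_singleton, h,
    Option.or_none, firstLabel]

theorem firstLabel_eq_some_iff {m : ℕ} {f : ℕ → Option Label} {l : Label} :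
    firstLabel m f = some l ↔ ∃ k < m, f k = some l ∧ ∀ j < k, f j = none := by
  induction m generalizing f with
  | zero => simp [firstLabel_zero]
  | succ m ih =>
    rw [firstLabel_succ, Option.or_eq_some_iff, ih]
    constructor
    · rintro (h | ⟨h0, k, hk, h1, h2⟩)
      · exact ⟨0, by omega, h, by simp⟩
      · refine ⟨k + 1, by omega, h1, fun j hj => ?_⟩
        cases j with
        | zero => exact h0
        | succ j => exact h2 j (by omega)
    · rintro ⟨k, hk, h1, h2⟩
      cases k with
      | zero => exact .inl h1
      | succ k => exact .inr ⟨h2 0 (by omega), k, by omega, h1, fun j hj => h2 (j + 1) (by omega)⟩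

/-- A finite column, extended by empty boxes. -/
def extendColumn {m : ℕ} (c : Fin m → Option Label) (i : ℕ) : Option Label :=
  if h : i < m then c ⟨i, h⟩ else none

theorem extendColumn_fin {m : ℕ} (c : Fin m → Option Label) (i : Fin m) :
    extendColumn c i = c i := by
  simp [extendColumn]

theorem extendColumn_of_le {m : ℕ} (c : Fin m → Option Label) {i : ℕ} (h : m ≤ i) :
    extendColumn c i = none := by
  simp [extendColumn, h]

theorem extendColumn_cons_zero {m : ℕ} (o : Option Label) (c : Fin m → Option Label) :
    extendColumn (Fin.cons o c : Fin (m + 1) → Option Label) 0 = o := by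
  simp [extendColumn]

theorem extendColumn_cons_succ {m : ℕ} (o : Option Label) (c : Fin m → Option Label) (i : ℕ) :
    extendColumn (Fin.cons o c : Fin (m + 1) → Option Label) (i + 1) = extendColumn c i := by
  by_cases h : i < m
  · rw [extendColumn, extendColumn, dif_pos h, dif_pos (Nat.succ_lt_succ h)]
    exact Fin.cons_succ (α := fun _ => Option Label) o c ⟨i, h⟩
  · rw [extendColumn_of_le c (by omega), extendColumn_of_le _ (by omega)]

/-- The topmost label of a column. -/
def topLabel {m : ℕ} (c : Fin m → Option Label) : Option Label :=
  firstLabel m (extendColumn c)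

/-- The closest label below the box `i` of a column. -/
def labelBelow {m : ℕ} (c : Fin m → Option Label) (i : ℕ) : Option Label :=
  firstLabel m fun k => extendColumn c (i + 1 + k)

theorem topLabel_cons {m : ℕ} (o : Option Label) (c : Fin m → Option Label) :
    topLabel (Fin.cons o c : Fin (m + 1) → Option Label) = o.or (topLabel c) := by
  simp only [topLabel, firstLabel_succ, extendColumn_cons_zero, extendColumn_cons_succ]

theorem labelBelow_cons_zero {m : ℕ} (o : Option Label) (c : Fin m → Option Label) :
    labelBelow (Fin.cons o c : Fin (m + 1) → Option Label) 0 = topLabel c := by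
  refine (firstLabel_succ_of_last_eq_none _ (by exact extendColumn_of_le _ (by omega))).trans
    (congrArg (firstLabel m) (funext fun k => ?_))
  rw [zero_add, add_comm 1 k, extendColumn_cons_succ]

theorem labelBelow_cons_succ {m : ℕ} (o : Option Label) (c : Fin m → Option Label) (i : ℕ) :
    labelBelow (Fin.cons o c : Fin (m + 1) → Option Label) (i + 1) = labelBelow c i := by
  refine (firstLabel_succ_of_last_eq_none _ (by exact extendColumn_of_le _ (by omega))).trans
    (congrArg (firstLabel m) (funext fun k => ?_))
  rw [add_right_comm, extendColumn_cons_succ]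

theorem sum_label {M : Type*} [AddCommMonoid M] (f : Label → M) :
    ∑ l, f l = f .alpha + (f .beta + (f .gamma + f .delta)) := by
  change ∑ l ∈ {Label.alpha, Label.beta, Label.gamma, Label.delta}, f l = _
  rw [Finset.sum_insert (by decide), Finset.sum_insert (by decide), Finset.sum_insert (by decide),
    Finset.sum_singleton]

/-! ### Transfer recursion for one column -/

section ColumnSum

open Polynomial StaircaseTableau

variable {R : Type*} [CommRing R]

/-- The factor of a box with content `o` in a new first column, if the row of the box starts with
the label `s` and the closest label below the box is `l`; it is `0` if `o` is not allowed. -/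
def boxFactor (α β γ δ q : R) (s o l : Option Label) : R :=
  match o with
  | none => if s = none then 0 else blankValue q 1 s l
  | some a =>
    if (s = some .beta ∨ s = some .delta) ∨ (l = some .alpha ∨ l = some .gamma) then 0
    else labelValue α β γ δ a

/-- The variable that records the first label of a row. -/
def statusValue (x z : R) : Option Label → R
  | some .alpha => x
  | some .gamma => x
  | some .delta => z
  | _ => 1

/-- The sum over all columns in front of rows that start with the labels `s`, weighted with a
function `h` of the topmost label. -/
noncomputable def columnSum (α β γ δ q w : R) (h : Option Label → R[X]) {m : ℕ}
    (s : Fin m → Option Label) : R[X] :=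
  ∑ c : Fin m → Option Label, h (topLabel c) *
    ∏ i, (C (boxFactor α β γ δ q (s i) (c i) (labelBelow c i)) *
      statusValue X (C w) ((c i).or (s i)))

theorem columnSum_zero (α β γ δ q w : R) (h : Option Label → R[X]) (s : Fin 0 → Option Label) :
    columnSum α β γ δ q w h s = h none := by
  simp [columnSum, topLabel, firstLabel_zero]

/-- The top box interacts with the boxes below only through their topmost label, so it can be
absorbed into the weight function `h`; this is why `h` is kept arbitrary. -/
theorem columnSum_succ (α β γ δ q w : R) (h : Option Label → R[X]) {m : ℕ}
    (s : Fin (m + 1) → Option Label) :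
    columnSum α β γ δ q w h s = columnSum α β γ δ q w (fun l => ∑ o, h (o.or l) *
      (C (boxFactor α β γ δ q (s 0) o l) * statusValue X (C w) (o.or (s 0)))) (Fin.tail s) := by
  rw [columnSum, ← (Fin.consEquiv fun _ => Option Label).sum_comp, Fintype.sum_prod_type,
    Finset.sum_comm, columnSum]
  refine Finset.sum_congr rfl fun c _ => ?_
  rw [Finset.sum_mul]
  refine Finset.sum_congr rfl fun o _ => ?_
  change h (topLabel (Fin.cons o c)) * ∏ i, (C (boxFactor α β γ δ q (s i)
    ((Fin.cons o c : Fin (m + 1) → Option Label) i) (labelBelow (Fin.cons o c) i)) *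
      statusValue X (C w) (((Fin.cons o c : Fin (m + 1) → Option Label) i).or (s i))) = _
  rw [Fin.prod_univ_succ]
  simp only [topLabel_cons, Fin.cons_zero, Fin.cons_succ, Fin.val_zero,
    Fin.val_succ, labelBelow_cons_zero, labelBelow_cons_succ, Fin.tail, mul_assoc]

/-- The sum over the columns with topmost label `l`, if `k` rows start with `α` or `γ`. -/
noncomputable def columnState (α β γ δ q w : R) : ℕ → Label → R[X]
  | 0, l => C (labelValue α β γ δ l) * statusValue X (C w) (some l)
  | k + 1, l => C (blankValue q 1 (some .alpha) (some l)) * X * columnState α β γ δ q w k l +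
      C (labelValue α β γ δ l) * statusValue X (C w) (some l) *
        (columnState α β γ δ q w k .beta + columnState α β γ δ q w k .delta)

theorem columnState_succ (α β γ δ q w : R) (k : ℕ) (l : Label) :
    columnState α β γ δ q w (k + 1) l =
      C (blankValue q 1 (some .alpha) (some l)) * X * columnState α β γ δ q w k l +
      C (labelValue α β γ δ l) * statusValue X (C w) (some l) *
        (columnState α β γ δ q w k .beta + columnState α β γ δ q w k .delta) := rfl

/-- Only the numbers `a` of rows starting with `α` or `γ` and `d` of rows starting with `δ` matter,
not their order. The row without label is the new bottom row, whose only box is diagonal. -/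
theorem exists_columnSum_eq (α β γ δ q w : R) (n : ℕ) (s : Fin (n + 1) → Option Label)
    (hlast : s (Fin.last n) = none) (hs : ∀ i : Fin n, s i.castSucc ≠ none) :
    ∃ a d : ℕ, (∀ x z : R[X], ∏ i : Fin n, statusValue x z (s i.castSucc) = x ^ a * z ^ d) ∧
      ∀ h, columnSum α β γ δ q w h s =
        C ((q * w) ^ d) * ∑ l, h (some l) * columnState α β γ δ q w a l := by
  induction n with
  | zero =>
    refine ⟨0, 0, by simp, fun h => ?_⟩
    rw [columnSum_succ, columnSum_zero, Fintype.sum_option]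
    have : s 0 = none := hlast
    simp [this, boxFactor, columnState]
  | succ n ih =>
    obtain ⟨a, d, hprod, hsum⟩ := ih (Fin.tail s) hlast fun i => hs i.succ
    have h0 : s 0 ≠ none := hs 0
    have hp : ∀ x z : R[X], ∏ i : Fin (n + 1), statusValue x z (s i.castSucc) =
        statusValue x z (s 0) * (x ^ a * z ^ d) := by
      intro x z
      rw [Fin.prod_univ_succ, ← hprod]
      rfl
    simp only [hp]
    have hrec := fun h => (columnSum_succ α β γ δ q w h s).trans (hsum _)
    simp only [hrec]
    match hs0 : s 0, h0 with
    | some .alpha, _ =>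
      refine ⟨a + 1, d, fun x z => by simp only [statusValue]; ring, fun h => ?_⟩
      congr 1
      simp [sum_label, Fintype.sum_option, boxFactor, columnState, statusValue, blankValue,
        labelValue]
      ring
    | some .gamma, _ =>
      refine ⟨a + 1, d, fun x z => by simp only [statusValue]; ring, fun h => ?_⟩
      congr 1
      simp [sum_label, Fintype.sum_option, boxFactor, columnState, statusValue, blankValue,
        labelValue]
      ring
    | some .beta, _ =>
      refine ⟨a, d, fun x z => by simp only [statusValue]; ring, fun h => ?_⟩
      congr 1
      simp [sum_label, Fintype.sum_option, boxFactor, statusValue, blankValue]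
    -- The new box is empty with factor `q`, and the row still starts with `δ`, which contributes
    -- `w`.
    | some .delta, _ =>
      refine ⟨a, d + 1, fun x z => by simp only [statusValue]; ring, fun h => ?_⟩
      simp [sum_label, Fintype.sum_option, boxFactor, statusValue, blankValue]
      ring

/-- The transfer recursion closes on the labels `β` and `δ`; the coefficients are the trace and the
determinant of that 2 by 2 block. Since the recursion is linear and independent of `k`, only `k = 0`
needs checking for all four labels. -/
theorem columnState_quadratic (α β γ q w : R) (k : ℕ) (l : Label) :
    columnState α β γ (-β) q w (k + 2) l =
      (C (1 + q) * X + C (β * (1 - w))) * columnState α β γ (-β) q w (k + 1) l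
        - (C q * X ^ 2 + C (β * (1 - q * w)) * X) * columnState α β γ (-β) q w k l := by
  induction k generalizing l with
  | zero =>
    cases l <;>
    · simp only [columnState, statusValue, labelValue, blankValue, map_add, map_sub, map_mul,
        map_one, map_neg]
      ring
  | succ k ih =>
    have h (k : ℕ) := columnState_succ α β γ (-β) q w k l
    linear_combination h (k + 2) + C (blankValue q 1 (some .alpha) (some l)) * X * ih l +
      C (labelValue α β γ (-β) l) * statusValue X (C w) (some l) * (ih .beta + ih .delta) -
      (C (1 + q) * X + C (β * (1 - w))) * h (k + 1) +
      (C q * X ^ 2 + C (β * (1 - q * w)) * X) * h k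

theorem sum_columnState (α β γ q w : R) (k : ℕ) :
    ∑ l, columnState α β γ (-β) q w k l = columnSeq α β γ q w k := by
  induction k using Nat.twoStepInduction with
  | zero =>
    simp only [sum_label, columnState, columnSeq, recurrentSeq, statusValue, labelValue, map_add,
      map_sub, map_mul, map_one, map_neg]
    ring
  | one =>
    simp only [sum_label, columnState, columnSeq, recurrentSeq, statusValue, labelValue,
      blankValue, map_add, map_sub, map_mul, map_one, map_neg]
    ring
  | more k h0 h1 =>
    rw [columnSeq, recurrentSeq, ← columnSeq, ← h0, ← h1, Finset.mul_sum, Finset.mul_sum,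
      ← Finset.sum_sub_distrib]
    exact Finset.sum_congr rfl fun l _ => columnState_quadratic α β γ q w k l

end ColumnSum

/-! ### Removing and adding the first column of a tableau -/

namespace StaircaseTableau

open Polynomial

variable {n : ℕ} {R : Type*} [CommRing R]

/-- The first label of row `i`. -/
def rowLabel (T : StaircaseTableau n) (i : ℕ) : Option Label :=
  firstLabel n (T.entry i)

theorem entry_eq_none (T : StaircaseTableau n) {i j : ℕ} (h : n ≤ i + j) : T.entry i j = none :=
  T.entry_outside i j (by rw [mem_staircaseShape]; omega)

theorem rowLabel_eq_none (T : StaircaseTableau n) {i : ℕ} (h : n ≤ i) : T.rowLabel i = none := by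
  rw [rowLabel, firstLabel, List.findSome?_eq_none_iff]
  exact fun j _ => T.entry_eq_none (by omega)

theorem rowLabel_ne_none (T : StaircaseTableau n) {i : ℕ} (h : i < n) : T.rowLabel i ≠ none := by
  rw [rowLabel, firstLabel, Ne, List.findSome?_eq_none_iff]
  intro h0
  exact T.diagonal i (n - 1 - i) (by omega) (h0 _ (by rw [List.mem_range]; omega))

theorem rowLabel_eq_of_entry (T : StaircaseTableau n) {i j : ℕ}
    (h : T.entry i j = some .beta ∨ T.entry i j = some .delta) : T.rowLabel i = T.entry i j := by
  have hj : j < n := by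
    by_contra hj
    rw [T.entry_eq_none (by omega)] at h
    simp at h
  have hl := fun j' hj' => T.left_empty i j j' hj' h
  obtain h | h := h <;> rw [h] <;> exact firstLabel_eq_some_iff.2 ⟨j, hj, h, hl⟩

/-- The tableau without its first column. -/
def tail (T : StaircaseTableau (n + 1)) : StaircaseTableau n where
  entry i j := T.entry i (j + 1)
  entry_outside i j h := T.entry_eq_none (by rw [mem_staircaseShape] at h; omega)
  diagonal i j h := T.diagonal i (j + 1) (by omega)
  left_empty i j j' h := T.left_empty i (j + 1) (j' + 1) (by omega)
  above_empty i i' j := T.above_empty i i' (j + 1)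

/-- The first column of a tableau. -/
def firstColumn (T : StaircaseTableau (n + 1)) : Fin (n + 1) → Option Label :=
  fun i => T.entry i 0

theorem extendColumn_firstColumn (T : StaircaseTableau (n + 1)) (i : ℕ) :
    extendColumn T.firstColumn i = T.entry i 0 := by
  by_cases h : i < n + 1
  · simp [extendColumn, h, firstColumn]
  · rw [extendColumn_of_le _ (by omega), T.entry_eq_none (by omega)]

theorem tail_firstColumn_injective :
    Function.Injective fun T : StaircaseTableau (n + 1) => (T.tail, T.firstColumn) := by
  intro S T h
  obtain ⟨h1, h2⟩ := Prod.mk.inj h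
  ext1
  funext i j
  cases j with
  | zero => rw [← extendColumn_firstColumn, ← extendColumn_firstColumn, h2]
  | succ j => exact congrFun (congrFun (congrArg entry h1) i) j

theorem rowLabel_succ (T : StaircaseTableau (n + 1)) (i : ℕ) :
    T.rowLabel i = (T.entry i 0).or (T.tail.rowLabel i) :=
  firstLabel_succ n _

theorem rightLabel_zero (T : StaircaseTableau (n + 1)) (i : ℕ) :
    T.rightLabel i 0 = T.tail.rowLabel i := by
  refine (firstLabel_succ_of_last_eq_none _ (by exact T.entry_eq_none (by omega))).trans ?_
  rw [rowLabel]
  congr 1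
  funext k
  rw [zero_add, add_comm 1 k]
  rfl

theorem belowLabel_zero (T : StaircaseTableau (n + 1)) (i : ℕ) :
    T.belowLabel i 0 = labelBelow T.firstColumn i := by
  simp only [labelBelow, extendColumn_firstColumn]
  rfl

theorem rightLabel_succ (T : StaircaseTableau (n + 1)) (i j : ℕ) :
    T.rightLabel i (j + 1) = T.tail.rightLabel i j := by
  refine (firstLabel_succ_of_last_eq_none _ (by exact T.entry_eq_none (by omega))).trans ?_
  rw [rightLabel, firstLabel]
  congr 1
  funext k
  rw [add_right_comm _ 1 k]
  rfl

theorem belowLabel_succ (T : StaircaseTableau (n + 1)) (i j : ℕ) :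
    T.belowLabel i (j + 1) = T.tail.belowLabel i j :=
  firstLabel_succ_of_last_eq_none _ (T.entry_eq_none (by omega))

theorem boxValue_succ (T : StaircaseTableau (n + 1)) (α β γ δ q u : R) (i j : ℕ) :
    T.boxValue α β γ δ q u i (j + 1) = T.tail.boxValue α β γ δ q u i j := by
  rw [boxValue, boxValue, rightLabel_succ, belowLabel_succ]
  rfl

theorem boxValue_zero (T : StaircaseTableau (n + 1)) (α β γ δ q : R) (i : Fin (n + 1)) :
    T.boxValue α β γ δ q 1 i 0 = boxFactor α β γ δ q (T.tail.rowLabel i) (T.firstColumn i)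
      (labelBelow T.firstColumn i) := by
  rw [boxValue, rightLabel_zero, belowLabel_zero]
  change _ = boxFactor α β γ δ q _ (T.entry i 0) _
  cases h : T.entry i 0 with
  | none =>
    refine (if_neg ?_).symm
    -- An empty box is off the diagonal, so its row is not the bottom one and meets the tail.
    refine T.tail.rowLabel_ne_none (lt_of_le_of_ne (Nat.le_of_lt_succ i.2) fun hi => ?_)
    exact T.diagonal i 0 (by omega) h
  | some a =>
    refine (if_neg ?_).symm
    have hrow : ∀ l, (l = Label.beta ∨ l = Label.delta) → T.tail.rowLabel i ≠ some l := by
      intro l hl hs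
      obtain ⟨k, -, hk, -⟩ := firstLabel_eq_some_iff.1 hs
      have := T.left_empty i (k + 1) 0 (by omega)
        (by rcases hl with rfl | rfl; exacts [.inl hk, .inr hk])
      simp [h] at this
    have hcol : ∀ l, (l = Label.alpha ∨ l = Label.gamma) →
        labelBelow T.firstColumn i ≠ some l := by
      intro l hl hs
      obtain ⟨k, -, hk, -⟩ := firstLabel_eq_some_iff.1 hs
      rw [extendColumn_firstColumn] at hk
      have := T.above_empty (i + 1 + k) i 0 (by omega)
        (by rcases hl with rfl | rfl; exacts [.inl hk, .inr hk])
      simp [h] at this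
    rintro ((h | h) | (h | h))
    exacts [hrow _ (.inl rfl) h, hrow _ (.inr rfl) h, hcol _ (.inl rfl) h, hcol _ (.inr rfl) h]

theorem wt_eq_prod_range (T : StaircaseTableau n) (α β γ δ q u : R) :
    T.wt α β γ δ q u =
      ∏ j ∈ Finset.range n, ∏ i ∈ Finset.range (n - j), T.boxValue α β γ δ q u i j := by
  refine Finset.prod_finset_product_right _ _ _ fun c => ?_
  rw [YoungDiagram.mem_cells, ← Prod.mk.eta (p := c), mem_staircaseShape, Finset.mem_range,
    Finset.mem_range]
  omega

theorem wt_succ (T : StaircaseTableau (n + 1)) (α β γ δ q : R) :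
    T.wt α β γ δ q 1 = T.tail.wt α β γ δ q 1 *
      ∏ i : Fin (n + 1), boxFactor α β γ δ q (T.tail.rowLabel i) (T.firstColumn i)
        (labelBelow T.firstColumn i) := by
  rw [wt_eq_prod_range, Finset.prod_range_succ', wt_eq_prod_range, Nat.sub_zero,
    Finset.prod_range fun i => T.boxValue α β γ δ q 1 i 0]
  congr 1
  · refine Finset.prod_congr rfl fun j _ => ?_
    rw [Nat.add_sub_add_right]
    exact Finset.prod_congr rfl fun i _ => T.boxValue_succ α β γ δ q 1 i j
  · exact Finset.prod_congr rfl fun i _ => T.boxValue_zero α β γ δ q i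

/-- A column with nonzero factors can be put in front of a tableau. -/
theorem exists_tail_firstColumn_eq (α β γ δ q : R) (T : StaircaseTableau n)
    (c : Fin (n + 1) → Option Label)
    (h : ∀ i : Fin (n + 1), boxFactor α β γ δ q (T.rowLabel i) (c i) (labelBelow c i) ≠ 0) :
    ∃ S : StaircaseTableau (n + 1), S.tail = T ∧ S.firstColumn = c := by
  have hne : ∀ i < n + 1, extendColumn c i = none → T.rowLabel i ≠ none := by
    intro i hi h0 hr
    apply h ⟨i, hi⟩
    simp [← extendColumn_fin, boxFactor, h0, hr]
  have hrow : ∀ i, (T.rowLabel i = some .beta ∨ T.rowLabel i = some .delta) →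
      extendColumn c i = none := by
    intro i hr
    by_contra h0
    have hi : i < n + 1 := by
      by_contra hi
      exact h0 (extendColumn_of_le c (by omega))
    obtain ⟨l, hl⟩ := Option.ne_none_iff_exists'.1 h0
    apply h ⟨i, hi⟩
    simp [← extendColumn_fin, boxFactor, hl, hr]
  have hcol : ∀ i, (labelBelow c i = some .alpha ∨ labelBelow c i = some .gamma) →
      extendColumn c i = none := by
    intro i hr
    by_contra h0
    have hi : i < n + 1 := by
      by_contra hi
      exact h0 (extendColumn_of_le c (by omega))
    obtain ⟨l, hl⟩ := Option.ne_none_iff_exists'.1 h0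
    apply h ⟨i, hi⟩
    simp [← extendColumn_fin, boxFactor, hl, hr]
  -- `boxFactor` tests only the closest label below. Going upwards from an `α` or `γ`, the boxes
  -- already passed are empty, so that label is still the closest one below the next box.
  have habove : ∀ i, (extendColumn c i = some .alpha ∨ extendColumn c i = some .gamma) →
      ∀ k < i, extendColumn c (i - 1 - k) = none := by
    intro i hi k
    induction k using Nat.strong_induction_on with
    | _ k ih =>
      intro hk
      apply hcol
      have hin : i < n + 1 := by
        by_contra hin
        rw [extendColumn_of_le c (by omega)] at hi
        simp at hi
      have hbelow : ∀ l, extendColumn c i = some l → labelBelow c (i - 1 - k) = some l := by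
        intro l hl
        refine firstLabel_eq_some_iff.2 ⟨k, by omega, ?_, fun j hj => ?_⟩
        · rwa [show i - 1 - k + 1 + k = i by omega]
        · have := ih (k - 1 - j) (by omega) (by omega)
          rwa [show i - 1 - k + 1 + j = i - 1 - (k - 1 - j) by omega]
      exact hi.imp (hbelow _) (hbelow _)
  let entry : ℕ → ℕ → Option Label := fun i j => Nat.casesOn j (extendColumn c i) (T.entry i)
  refine ⟨⟨entry, ?_, ?_, ?_, ?_⟩, rfl, funext fun i => extendColumn_fin c i⟩
  · intro i j hij
    rw [mem_staircaseShape] at hij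
    cases j with
    | zero => exact extendColumn_of_le c (by omega)
    | succ j => exact T.entry_eq_none (by omega)
  · intro i j hij
    cases j with
    | zero => exact fun h0 => hne i (by omega) h0 (T.rowLabel_eq_none (by omega))
    | succ j => exact T.diagonal i j (by omega)
  · intro i j j' hj he
    cases j with
    | zero => omega
    | succ j =>
      cases j' with
      | zero =>
        apply hrow
        rwa [T.rowLabel_eq_of_entry he]
      | succ j' => exact T.left_empty i j j' (by omega) he
  · intro i i' j hi he
    cases j with
    | zero =>
      have := habove i he (i - 1 - i') (by omega)
      rwa [show i - 1 - (i - 1 - i') = i' by omega] at this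
    | succ j => exact T.above_empty i i' j hi he

/-- The generating polynomial of the tableaux of size `n`: the variable marks the rows that start
with `α` or `γ`, and `w` marks the rows that start with `δ`. -/
noncomputable def rowPolynomial (α β γ δ q : R) (n : ℕ) (w : R) : R[X] :=
  ∑ T : StaircaseTableau n,
    C (T.wt α β γ δ q 1) * ∏ i : Fin n, statusValue X (C w) (T.rowLabel i)

/-- Summing over all pairs of a tableau and a column is harmless: pairs that do not form a tableau
have a vanishing `boxFactor`. -/
theorem rowPolynomial_succ_eq_sum_columnSum (α β γ δ q : R) (n : ℕ) (w : R) :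
    rowPolynomial α β γ δ q (n + 1) w = ∑ T : StaircaseTableau n,
      C (T.wt α β γ δ q 1) *
        columnSum α β γ δ q w (fun _ => 1) fun i : Fin (n + 1) => T.rowLabel i := by
  simp only [columnSum, one_mul, Finset.mul_sum]
  rw [← Fintype.sum_prod_type' fun (T : StaircaseTableau n) (c : Fin (n + 1) → Option Label) =>
    C (T.wt α β γ δ q 1) * ∏ i : Fin (n + 1),
      (C (boxFactor α β γ δ q (T.rowLabel i) (c i) (labelBelow c i)) *
        statusValue X (C w) ((c i).or (T.rowLabel i)))]
  refine Fintype.sum_of_injective _ tail_firstColumn_injective _ _ ?_ ?_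
  · rintro ⟨T, c⟩ hTc
    by_contra h0
    apply hTc
    obtain ⟨S, hS, hS'⟩ := exists_tail_firstColumn_eq α β γ δ q T c fun i hi => h0 <| by
      dsimp only
      rw [Finset.prod_eq_zero (Finset.mem_univ i) (by rw [hi, map_zero, zero_mul]), mul_zero]
    exact ⟨S, Prod.ext hS hS'⟩
  · intro T
    dsimp only
    rw [wt_succ, map_mul, map_prod, mul_assoc, ← Finset.prod_mul_distrib]
    congr 1
    exact Finset.prod_congr rfl fun i _ => by rw [rowLabel_succ]; rfl

theorem rowPolynomial_succ (α β γ q : R) (n : ℕ) (w : R) :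
    rowPolynomial α β γ (-β) q (n + 1) w =
      columnOperator α β γ q w (rowPolynomial α β γ (-β) q n (q * w)) := by
  rw [rowPolynomial_succ_eq_sum_columnSum, rowPolynomial, map_sum]
  refine Finset.sum_congr rfl fun T _ => ?_
  obtain ⟨a, d, hprod, hsum⟩ := exists_columnSum_eq α β γ (-β) q w n
    (fun i : Fin (n + 1) => T.rowLabel i) (T.rowLabel_eq_none le_rfl)
    fun i => T.rowLabel_ne_none i.2
  -- The old tableau contributes the monomial `X ^ a * (q * w) ^ d` to the polynomial at `q * w`;
  -- the operator sends it to the column sum.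
  rw [hsum, linearMap_C_mul]
  simp only [Fin.val_castSucc] at hprod
  rw [hprod, ← map_pow, mul_comm (X ^ a), linearMap_C_mul, columnOperator, seqOperator_X_pow,
    ← sum_columnState]
  simp only [one_mul]

theorem rowPolynomial_zero (α β γ δ q : R) (w : R) : rowPolynomial α β γ δ q 0 w = 1 := by
  let T₀ : StaircaseTableau 0 := ⟨fun _ _ => none, fun _ _ _ => rfl, fun _ _ h => by omega,
    fun _ _ _ _ _ => rfl, fun _ _ _ _ _ => rfl⟩
  have hT : ∀ T : StaircaseTableau 0, T = T₀ := by
    intro T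
    ext1
    funext i j
    exact T.entry_eq_none (Nat.zero_le _)
  rw [rowPolynomial, Fintype.sum_eq_single T₀ fun T h => absurd (hT T) h, wt_eq_prod_range]
  simp

theorem rowPolynomial_eq_columnIterate (α β γ q : R) (n : ℕ) (w : R) :
    rowPolynomial α β γ (-β) q n w = columnIterate α β γ q n w := by
  induction n generalizing w with
  | zero => rw [rowPolynomial_zero, columnIterate]
  | succ n ih => rw [rowPolynomial_succ, ih, columnIterate]

theorem eval_rowPolynomial (α β γ δ q : R) (n : ℕ) :
    (rowPolynomial α β γ δ q n 1).eval 1 = fugacityZ n 1 α β γ δ q := by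
  have h : ∀ o : Option Label, (statusValue X 1 o : R[X]).eval 1 = 1 := by
    rintro (_ | _ | _ | _ | _) <;> simp [statusValue]
  simp [rowPolynomial, fugacityZ, eval_finsetSum, eval_prod, h]

end StaircaseTableau

theorem proposition4p6 {R : Type*} [CommRing R] (n : ℕ) (α β γ q : R) :
    fugacityZ n 1 α β γ (-β) q = ∏ j ∈ Finset.range n, (α + q ^ j * γ) := by
  rw [← StaircaseTableau.eval_rowPolynomial, StaircaseTableau.rowPolynomial_eq_columnIterate,
    columnIterate_one, Polynomial.eval_mul, Polynomial.eval_C, Polynomial.eval_pow,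
    Polynomial.eval_X, one_pow, mul_one]
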